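/- Write $\bar m=-m$. A signed permutation is a permutation $w$ of $\mathbb Z$ with $w(\bar\imath)=\overline{w(i)}$ for all $i$; it belongs to $\mathcal W_n$ if $w(m)=m$ for all $m>n$. Let $\boldsymbol\tau=(\mathbf k,\mathbf p,\mathbf q)$ consist of three $s$-tuples of integers ($s\ge 0$) with $$0<k_1<\dots<k_s,\qquad p_1\ge\dots\ge p_s>0,\qquad q_1\ge\dots\ge q_s .$$ Put $k_0=0$ and $q_0=+\infty$. The *construction algorithm* has $s+1$ steps. For $1\le i\le s$, Step $(i)$ fills the first $k_i-k_{i-1}$ positions $\ge p_i$ that are still available, from left to right and in increasing order, with the $k_i-k_{i-1}$ largest numbers $x\le -q_i$ that are unused, where a nonzero integer $x$ is unused if no entry of absolute value $|x|$ has been placed before. Step $(s+1)$ fills the remaining positive positions, from left to right, with the unused positive numbers in increasing order. The result, extended by $w(0)=0$ and $w(\bar\imath)=\overline{w(i)}$, is denoted $w(\boldsymbol\tau)$. Call $\boldsymbol\tau$ a *theta-triple* if * A1. $q_i\ne 0$ for all $i$; * A2. $q_i\neq -q_j$ for all $i\ne j$; * A3. if $s\ge 1$ and $q_s<0$, then $p_s>1$;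 and, where $a\in\{1,\dots,s+1\}$ is the index with $q_{a-1}>0>q_a$ ($a=1$ if all $q_i$ are negative, $a=s+1$ if all are positive) and, for $a\le i\le s$, $R(i)\in\{0,\dots,a-1\}$ is the unique index with $q_{R(i)}>-q_i>q_{R(i)+1}$, * B1. $(p_i-p_{i+1})+(q_i-q_{i+1})>k_{i+1}-k_i$ for $1\le i<a-1$; * B2. $(p_i-p_{i+1})+(q_i-q_{i+1})>(k_{i+1}-k_i)+(k_{R(i)}-k_{R(i+1)})$ for $a\le i<s$; * B3. $p_s+q_s+k_s>k_{R(s)}+1$ if $a\le s$; * C1. $-q_i\ge k_i-k_{R(i)}$ for all $a\le i\le s$; * C2$'$. for all $a\le i\le s$, all entries placed by Steps $(R(i)+1),\dots,(a-1)$ are strictly bigger than $q_i$. A signed permutation $w$ (in some $\mathcal W_n$) is *theta-vexillary* if $w=w(\boldsymbol\tau)$ for some theta-triple $\boldsymbol\tau$. **Proposition.** Each theta-vexillary signed permutation comes from exactly one theta-triple. That is, if $w(\boldsymbol\tau)=w(\tilde{\boldsymbol\tau})$ for theta-triples $\boldsymbol\tau$ and $\tilde{\boldsymbol\tau}$, then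 $\boldsymbol\tau=\tilde{\boldsymbol\tau}$. -/

import Mathlib

/-- Three `s`-tuples of integers `k = (k₁,…,k_s)`, `p = (p₁,…,p_s)`, `q = (q₁,…,q_s)`. The tuples
are stored with indices `0, …, s-1`; the accessors `K`, `P`, `Q` below use indices `1, …, s`. -/
structure ThetaData where
  s : ℕ
  k : Fin s → ℤ
  p : Fin s → ℤ
  q : Fin s → ℤ

namespace ThetaData

/-- `k_i` for `1 ≤ i ≤ s`, and `k_0 = 0` (the value for `i > s` is never used). -/
def K (τ : ThetaData) (i : ℕ) : ℤ :=
  if h : 1 ≤ i ∧ i ≤ τ.s then τ.k ⟨i - 1, by omega⟩ else 0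

/-- `p_i` for `1 ≤ i ≤ s` (other values are never used). -/
def P (τ : ThetaData) (i : ℕ) : ℤ :=
  if h : 1 ≤ i ∧ i ≤ τ.s then τ.p ⟨i - 1, by omega⟩ else 0

/-- `q_i` for `1 ≤ i ≤ s` (other values are never used). -/
def Q (τ : ThetaData) (i : ℕ) : ℤ :=
  if h : 1 ≤ i ∧ i ≤ τ.s then τ.q ⟨i - 1, by omega⟩ else 0

/-- The index `a` with `q_{a-1} > 0 > q_a`: `a - 1` is the largest index of a positive `q`,
and `a = 1` if there is none. -/
def a (τ : ThetaData) : ℕ :=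
  Nat.findGreatest (fun j => 0 < τ.Q j) τ.s + 1

/-- The index `R(i)` with `q_{R(i)} > -q_i > q_{R(i)+1}`, where `q_0 = +∞`: the largest index `j`
with `q_j > -q_i`, and `0` if there is none. -/
def R (τ : ThetaData) (i : ℕ) : ℕ :=
  Nat.findGreatest (fun j => -τ.Q i < τ.Q j) τ.s

/-- A partial filling of the positions: `f z = some x` if the entry `x` has been placed at the
position `z`, and `f z = none` if `z` is still available. -/
abbrev Filling := ℤ → Option ℤ

/-- The nonzero integer `x` may still be placed: no entry with absolute value `|x|` has been. -/
def Unused (f : Filling) (x : ℤ) : Prop :=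
  x ≠ 0 ∧ ∀ z y, f z = some y → |y| ≠ |x|

/-- The number of available positions `z'` with `b ≤ z' < z`. -/
noncomputable def vacantBefore (f : Filling) (b z : ℤ) : ℕ :=
  ((Finset.Ico b z).filter (fun z' => f z' = none)).card

/-- The unused numbers `x ≤ b`, listed downwards from the largest one (`t = 0, 1, 2, …`). -/
noncomputable def unusedBelow (f : Filling) (b : ℤ) (t : ℕ) : ℤ :=
  b - (Nat.nth (fun d : ℕ => Unused f (b - d)) t : ℕ)

/-- One step: the first `m` available positions `≥ p` receive, in increasing order, the `m` largest
unused numbers `≤ -q`. -/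
noncomputable def step (f : Filling) (m : ℕ) (p q : ℤ) : Filling := fun z =>
  if f z = none ∧ p ≤ z ∧ vacantBefore f p z < m then
    some (unusedBelow f (-q) (m - 1 - vacantBefore f p z))
  else f z

/-- The filling after Steps `(1), …, (i)`. Step `(i)` places `k_i - k_{i-1}` entries. -/
noncomputable def fill (τ : ThetaData) : ℕ → Filling
  | 0 => fun _ => none
  | i + 1 => step (fill τ i) (τ.K (i + 1) - τ.K i).toNat (τ.P (i + 1)) (τ.Q (i + 1))

/-- Theta-triples. -/
structure IsThetaTriple (τ : ThetaData) : Prop where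
  k_pos : ∀ i, 0 < τ.k i
  k_strictMono : StrictMono τ.k
  p_antitone : Antitone τ.p
  p_pos : ∀ i, 0 < τ.p i
  q_antitone : Antitone τ.q
  A1 : ∀ i, τ.q i ≠ 0
  A2 : ∀ i j, i ≠ j → τ.q i ≠ -τ.q j
  A3 : τ.Q τ.s < 0 → 1 < τ.P τ.s
  B1 : ∀ i, 1 ≤ i → i + 1 < τ.a →
    (τ.P i - τ.P (i + 1)) + (τ.Q i - τ.Q (i + 1)) > τ.K (i + 1) - τ.K i
  B2 : ∀ i, τ.a ≤ i → i < τ.s →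
    (τ.P i - τ.P (i + 1)) + (τ.Q i - τ.Q (i + 1)) >
      (τ.K (i + 1) - τ.K i) + (τ.K (τ.R i) - τ.K (τ.R (i + 1)))
  B3 : τ.a ≤ τ.s → τ.P τ.s + τ.Q τ.s + τ.K τ.s > τ.K (τ.R τ.s) + 1
  C1 : ∀ i, τ.a ≤ i → i ≤ τ.s → -τ.Q i ≥ τ.K i - τ.K (τ.R i)
  /-- All entries placed by Steps `(R(i)+1), …, (a-1)` of the construction are strictly bigger
  than `q_i`; void if `R(i) = a - 1`. -/
  C2 : ∀ i, τ.a ≤ i → i ≤ τ.s → ∀ z x,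
    τ.fill (τ.R i) z = none → τ.fill (τ.a - 1) z = some x → τ.Q i < x

/-- The entry at the position `z ≥ 1` after the last Step `(s+1)`, in which the remaining positions
receive the unused positive numbers in increasing order. -/
noncomputable def entry (τ : ThetaData) (z : ℤ) : ℤ :=
  match fill τ τ.s z with
  | some x => x
  | none => (Nat.nth (fun x : ℕ => Unused (fill τ τ.s) (x : ℤ))
      (vacantBefore (fill τ τ.s) 1 z) : ℕ)

/-- The signed permutation `w(τ)` in full form, as an odd function on `ℤ`. -/
noncomputable def w (τ : ThetaData) (z : ℤ) : ℤ :=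
  if 0 < z then entry τ z else if z = 0 then 0 else -entry τ (-z)

end ThetaData

/-- The group `W_n` of signed permutations, inside the permutations of `ℤ`: those `w` with
`w(-i) = -w(i)` for all `i` and `w(m) = m` for all `m > n`. -/
def signedPerm (n : ℕ) : Subgroup (Equiv.Perm ℤ) where
  carrier := {w | (∀ i, w (-i) = -w i) ∧ ∀ m : ℤ, (n : ℤ) < m → w m = m}
  mul_mem' := by
    rintro u v ⟨hu, hu'⟩ ⟨hv, hv'⟩
    refine ⟨fun i => ?_, fun m hm => ?_⟩
    · simp only [Equiv.Perm.mul_apply, hv, hu]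
    · simp only [Equiv.Perm.mul_apply, hv' m hm, hu' m hm]
  one_mem' := ⟨fun _ => rfl, fun _ _ => rfl⟩
  inv_mem' := by
    rintro u ⟨hu, hu'⟩
    refine ⟨fun i => ?_, fun m hm => ?_⟩
    · rw [Equiv.Perm.inv_eq_iff_eq, hu]; simp
    · rw [Equiv.Perm.inv_eq_iff_eq, hu' m hm]

/-- `w` is the signed permutation `w(τ)` of the theta-triple `τ`. -/
def ComesFrom (w : Equiv.Perm ℤ) (τ : ThetaData) : Prop :=
  τ.IsThetaTriple ∧ ∀ i, w i = τ.w i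

/-- A signed permutation is theta-vexillary if it comes from some theta-triple. -/
def IsThetaVexillary (w : Equiv.Perm ℤ) : Prop :=
  ∃ τ, ComesFrom w τ

/-! The triple can be read off from `w`. Steps (1), …, (i) fill exactly the positions `z ≥ p_i` with
`w z ≤ -q_i` (`filled_eq`), so the pair (p_i, q_i) determines k_i as the size of that region. The
reason is a count: by B1, B2, C1 and C2, a step between q's of equal sign has fewer entries to place
than there are vacant positions between consecutive p's plus unused values between consecutive -q's.
Together with B3 for the final step and a sign argument where q changes sign, this keeps all later
entries out of the region, with a margin of one (`later_avoids_corner`). The margin makes every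
(p_i, q_i) a corner of `w` (`isCorner`).

Not every corner need be such a pair. An extra corner (p, q) has p = p_j and q_j < q < 0 for some j,
and all values in (-q, -q_j] occur up to sign at positions ≥ p (`exists_of_isCorner`). Between two
pairs of one triple at the same position this cannot happen: some intermediate value is missing
there (`exists_unused_of_P_eq`). If a pair of one triple were an extra corner for the other,
applying the dichotomy once in each direction would contradict this (`exists_corner_eq`). Hence both
triples have the same pairs, and so the same k's. -/

namespace ThetaData

/-! ### Partial fillings: vacant positions and unused values -/

/-- The set of filled positions. -/
def filled (f : Filling) : Set ℤ := {z | f z ≠ none}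

theorem exists_abs_bound {f : Filling} (hf : (filled f).Finite) :
    ∃ M : ℤ, 0 ≤ M ∧ ∀ z y, f z = some y → |y| ≤ M := by
  have h1 : ((fun z => |(f z).getD 0|) '' filled f).Finite := hf.image _
  obtain ⟨M, hM⟩ := h1.bddAbove
  refine ⟨max M 0, le_max_right _ _, fun z y hy => le_max_of_le_left ?_⟩
  refine hM ⟨z, ?_, ?_⟩
  · simp [filled, hy]
  · simp [hy]

theorem unused_of_abs_gt {f : Filling} {M x : ℤ} (h0 : 0 ≤ M)
    (hM : ∀ z y, f z = some y → |y| ≤ M) (hx : M < |x|) : Unused f x := by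
  refine ⟨?_, fun z y hy => ?_⟩
  · rintro rfl
    simp at hx; omega
  · have := hM z y hy
    omega

/-- Infinitude makes `Nat.nth` a genuine enumeration, which never returns its default value 0 for
lack of elements. -/
theorem infinite_unused_below {f : Filling} (hf : (filled f).Finite) (b : ℤ) :
    {d : ℕ | Unused f (b - d)}.Infinite := by
  obtain ⟨M, h0, hM⟩ := exists_abs_bound hf
  refine Set.infinite_of_forall_exists_gt fun n => ⟨n + (b.toNat + M.toNat + 1), ?_, by omega⟩
  refine unused_of_abs_gt h0 hM ?_
  rw [abs_of_neg] <;> push_cast <;> omega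

theorem infinite_unused_nat {f : Filling} (hf : (filled f).Finite) :
    {x : ℕ | Unused f (x : ℤ)}.Infinite := by
  obtain ⟨M, h0, hM⟩ := exists_abs_bound hf
  refine Set.infinite_of_forall_exists_gt fun n => ⟨n + (M.toNat + 1), ?_, by omega⟩
  refine unused_of_abs_gt h0 hM ?_
  rw [abs_of_nonneg] <;> push_cast <;> omega

theorem infinite_vacant {f : Filling} (hf : (filled f).Finite) (p : ℤ) :
    {d : ℕ | f (p + d) = none}.Infinite := by
  intro h
  have hinj : Set.InjOn (fun d : ℕ => p + (d : ℤ)) {d : ℕ | f (p + d) ≠ none} := by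
    intro a _ b _ hab
    simpa using hab
  have h2 : {d : ℕ | f (p + d) ≠ none}.Finite :=
    Set.Finite.of_finite_image (hf.subset (by rintro _ ⟨d, hd, rfl⟩; exact hd)) hinj
  have h3 := h.union h2
  refine Set.infinite_univ (h3.subset fun d _ => ?_)
  exact em (f (p + d) = none)

theorem vacantBefore_eq_count (f : Filling) (p : ℤ) (d : ℕ) [DecidablePred fun d : ℕ => f (p + d) = none] :
    vacantBefore f p (p + d) = Nat.count (fun d : ℕ => f (p + d) = none) d := by
  rw [vacantBefore, Nat.count_eq_card_filter_range]
  symm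
  refine Finset.card_bij (fun (c : ℕ) _ => p + (c : ℤ)) ?_ ?_ ?_
  · intro c hc
    simp only [Finset.mem_filter, Finset.mem_range, Finset.mem_Ico] at hc ⊢
    exact ⟨by omega, hc.2⟩
  · intro c _ c' _ h
    simpa using h
  · intro z hz
    simp only [Finset.mem_filter, Finset.mem_range, Finset.mem_Ico] at hz ⊢
    refine ⟨(z - p).toNat, ⟨by omega, ?_⟩, by omega⟩
    rw [show p + ((z - p).toNat : ℤ) = z by omega]
    exact hz.2

theorem vacantBefore_mono (f : Filling) (p : ℤ) {z z' : ℤ} (h : z ≤ z') :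
    vacantBefore f p z ≤ vacantBefore f p z' :=
  Finset.card_le_card (Finset.filter_subset_filter _ (Finset.Ico_subset_Ico_right h))

theorem vacantBefore_lt {f : Filling} {p z z' : ℤ} (hp : p ≤ z) (h : z < z') (hz : f z = none) :
    vacantBefore f p z < vacantBefore f p z' := by
  refine Finset.card_lt_card ((Finset.ssubset_iff_of_subset
    (Finset.filter_subset_filter _ (Finset.Ico_subset_Ico_right h.le))).2 ⟨z, ?_, ?_⟩)
  · simp [hp, h, hz]
  · simp

theorem vacantBefore_eq_of_forall {f : Filling} {p z : ℤ} (h : p ≤ z)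
    (hv : ∀ y, p ≤ y → y < z → f y = none) : (vacantBefore f p z : ℤ) = z - p := by
  rw [vacantBefore, Finset.filter_true_of_mem, Int.card_Ico]
  · omega
  · intro y hy
    rw [Finset.mem_Ico] at hy
    exact hv y hy.1 hy.2

theorem exists_vacantBefore_eq {f : Filling} (hf : (filled f).Finite) (p : ℤ) (t : ℕ) :
    ∃ z, p ≤ z ∧ f z = none ∧ vacantBefore f p z = t := by
  classical
  refine ⟨p + (Nat.nth (fun d : ℕ => f (p + d) = none) t : ℕ), by omega,
    Nat.nth_mem_of_infinite (infinite_vacant hf p) t, ?_⟩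
  rw [vacantBefore_eq_count, Nat.count_nth_of_infinite (infinite_vacant hf p)]

theorem unused_unusedBelow {f : Filling} (hf : (filled f).Finite) (b : ℤ) (t : ℕ) :
    Unused f (unusedBelow f b t) :=
  Nat.nth_mem_of_infinite (infinite_unused_below hf b) t

theorem unusedBelow_le (f : Filling) (b : ℤ) (t : ℕ) : unusedBelow f b t ≤ b := by
  rw [unusedBelow]; omega

theorem unusedBelow_strictAnti {f : Filling} (hf : (filled f).Finite) (b : ℤ) :
    StrictAnti (unusedBelow f b) := by
  intro t u h
  have := Nat.nth_strictMono (infinite_unused_below hf b) h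
  rw [unusedBelow, unusedBelow]
  omega

/-- The number of unused `v` with `c < v ≤ b`. -/
noncomputable def unusedCount (f : Filling) (c b : ℤ) : ℕ :=
  {v | c < v ∧ v ≤ b ∧ Unused f v}.ncard

theorem finite_unused_Ioc (f : Filling) (c b : ℤ) : {v | c < v ∧ v ≤ b ∧ Unused f v}.Finite :=
  (Set.finite_Ioc c b).subset fun _ h => ⟨h.1, h.2.1⟩

theorem count_unused_below (f : Filling) (b : ℤ) (n : ℕ) [DecidablePred fun d : ℕ => Unused f (b - d)] :
    Nat.count (fun d : ℕ => Unused f (b - d)) n = unusedCount f (b - n) b := by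
  rw [Nat.count_eq_card_filter_range, unusedCount, ← Set.ncard_coe_finset]
  refine Set.ncard_congr (fun (d : ℕ) _ => b - (d : ℤ)) ?_ ?_ ?_
  · intro d hd
    simp only [Finset.coe_filter, Finset.mem_range, Set.mem_ofPred_eq] at hd ⊢
    exact ⟨by omega, by omega, hd.2⟩
  · intro d d' _ _ h
    simpa using h
  · intro v hv
    simp only [Finset.coe_filter, Finset.mem_range, Set.mem_ofPred_eq] at hv ⊢
    refine ⟨(b - v).toNat, ⟨by omega, ?_⟩, by omega⟩
    rw [show b - ((b - v).toNat : ℤ) = v by omega]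
    exact hv.2.2

theorem lt_unusedBelow_of_lt_unusedCount {f : Filling} {b c : ℤ} {t : ℕ} (hcb : c ≤ b)
    (h : t < unusedCount f c b) : c < unusedBelow f b t := by
  classical
  have h1 := count_unused_below f b (b - c).toNat
  rw [show b - ((b - c).toNat : ℤ) = c by omega] at h1
  rw [← h1] at h
  have := Nat.nth_lt_of_lt_count h
  rw [unusedBelow]
  omega

theorem exists_unusedBelow_eq {f : Filling} {b y : ℤ} (hy : y ≤ b) (h : Unused f y) :
    ∃ t, unusedBelow f b t = y := by
  classical
  refine ⟨Nat.count (fun d : ℕ => Unused f (b - d)) (b - y).toNat, ?_⟩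
  rw [unusedBelow, Nat.nth_count (p := fun d : ℕ => Unused f (b - d))]
  · omega
  · rwa [show b - ((b - y).toNat : ℤ) = y by omega]

/-! ### A single step of the construction -/

section Step

variable {f : Filling} {m : ℕ} {p q z z' x x' y : ℤ}

theorem step_of_eq_some (h : f z = some x) : step f m p q z = some x := by
  simp [step, h]

theorem step_eq_some_iff (h : f z = none) : step f m p q z = some x ↔
    p ≤ z ∧ vacantBefore f p z < m ∧
      x = unusedBelow f (-q) (m - 1 - vacantBefore f p z) := by
  by_cases h1 : p ≤ z ∧ vacantBefore f p z < m
  · simp [step, h, h1, eq_comm]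
  · have : step f m p q z = none := by
      simp only [step, h, true_and, if_neg h1]
    rw [this]
    simp only [reduceCtorEq, false_iff]
    tauto

theorem step_ne_none_iff (h : f z = none) : step f m p q z ≠ none ↔
    p ≤ z ∧ vacantBefore f p z < m := by
  by_cases h1 : p ≤ z ∧ vacantBefore f p z < m <;> simp [step, h, h1]

theorem step_pos_ge (h : f z = none) (hx : step f m p q z = some x) : p ≤ z :=
  ((step_eq_some_iff h).1 hx).1

theorem step_val_le (h : f z = none) (hx : step f m p q z = some x) : x ≤ -q := by
  rw [((step_eq_some_iff h).1 hx).2.2]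
  exact unusedBelow_le _ _ _

theorem step_val_unused (hf : (filled f).Finite) (h : f z = none)
    (hx : step f m p q z = some x) : Unused f x := by
  rw [((step_eq_some_iff h).1 hx).2.2]
  exact unused_unusedBelow hf _ _

theorem step_leftmost (h : f z = none) (hx : step f m p q z = some x) (hp : p ≤ z')
    (hz : z' ≤ z) : step f m p q z' ≠ none := by
  rcases hfz : f z' with _ | y
  · rw [step_ne_none_iff hfz]
    exact ⟨hp, (vacantBefore_mono f p hz).trans_lt ((step_eq_some_iff h).1 hx).2.1⟩
  · simp [step_of_eq_some hfz]

theorem step_strictMono (hf : (filled f).Finite) (h : f z = none) (hx : step f m p q z = some x)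
    (h' : f z' = none) (hx' : step f m p q z' = some x') (hz : z < z') : x < x' := by
  obtain ⟨h1, h2, rfl⟩ := (step_eq_some_iff h).1 hx
  obtain ⟨h3, h4, rfl⟩ := (step_eq_some_iff h').1 hx'
  have := vacantBefore_lt h1 hz h
  exact unusedBelow_strictAnti hf _ (by omega)

theorem exists_step_eq_unusedBelow (hf : (filled f).Finite) {t : ℕ} (ht : t < m) :
    ∃ z, f z = none ∧ step f m p q z = some (unusedBelow f (-q) t) := by
  obtain ⟨z, hz, hfz, hv⟩ := exists_vacantBefore_eq hf p (m - 1 - t)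
  refine ⟨z, hfz, (step_eq_some_iff hfz).2 ⟨hz, by omega, ?_⟩⟩
  congr 1
  omega

/-- A step takes the largest unused values, so it leaves no gap between a value it places and `-q`.
-/
theorem step_topmost (hf : (filled f).Finite) (h : f z = none) (hx : step f m p q z = some x)
    (hxy : x ≤ y) (hy : y ≤ -q) (hu : Unused f y) :
    ∃ z', f z' = none ∧ step f m p q z' = some y := by
  obtain ⟨h1, h2, rfl⟩ := (step_eq_some_iff h).1 hx
  obtain ⟨t, rfl⟩ := exists_unusedBelow_eq hy hu
  have := (unusedBelow_strictAnti hf (-q)).le_iff_ge.1 hxy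
  exact exists_step_eq_unusedBelow hf (by omega)

theorem exists_step_eq_neg (hf : (filled f).Finite) (hm : 0 < m) (hu : Unused f (-q)) :
    ∃ z, f z = none ∧ step f m p q z = some (-q) := by
  obtain ⟨z, hz, hx⟩ := exists_step_eq_unusedBelow (p := p) (q := q) hf hm
  exact step_topmost hf hz hx (unusedBelow_le _ _ _) le_rfl hu

theorem step_start_ne_none (hm : 0 < m) : step f m p q p ≠ none := by
  rcases hfz : f p with _ | y
  · rw [step_ne_none_iff hfz]
    simpa [vacantBefore] using hm
  · simp [step_of_eq_some hfz]

theorem filled_subset_filled_step : filled f ⊆ filled (step f m p q) := by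
  intro z hz
  obtain ⟨x, hx⟩ := Option.ne_none_iff_exists'.1 hz
  simp [filled, step_of_eq_some hx]

theorem ncard_new_step (hf : (filled f).Finite) :
    (filled (step f m p q) \ filled f).Finite ∧
      (filled (step f m p q) \ filled f).ncard = m := by
  have hbij : Set.BijOn (vacantBefore f p) (filled (step f m p q) \ filled f)
      (Set.Iio m) := by
    have key : ∀ z ∈ filled (step f m p q) \ filled f,
        f z = none ∧ p ≤ z ∧ vacantBefore f p z < m := by
      rintro z ⟨hz, hz'⟩
      have h0 : f z = none := by simpa [filled] using hz'
      exact ⟨h0, (step_ne_none_iff h0).1 hz⟩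
    refine ⟨fun z hz => (key z hz).2.2, ?_, ?_⟩
    · intro z hz z' hz' h
      have h1 := key z hz
      have h2 := key z' hz'
      rcases lt_trichotomy z z' with hlt | heq | hlt
      · exact absurd h (vacantBefore_lt h1.2.1 hlt h1.1).ne
      · exact heq
      · exact absurd h.symm (vacantBefore_lt h2.2.1 hlt h2.1).ne
    · intro t ht
      obtain ⟨z, hz, hfz, hv⟩ := exists_vacantBefore_eq hf p t
      refine ⟨z, ⟨(step_ne_none_iff hfz).2 ⟨hz, hv ▸ ht⟩, by simp [filled, hfz]⟩, hv⟩
  constructor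
  · exact (hbij.finite_iff_finite).2 (Set.finite_Iio m)
  · rw [← hbij.injOn.ncard_image, hbij.image_eq]
    simp [Set.ncard_eq_toFinset_card']

theorem finite_filled_step (hf : (filled f).Finite) : (filled (step f m p q)).Finite := by
  have := (ncard_new_step (m := m) (p := p) (q := q) hf).1.union hf
  exact this.subset (by rw [Set.sdiff_union_self]; exact Set.subset_union_left)

theorem ncard_filled_step (hf : (filled f).Finite) :
    (filled (step f m p q)).ncard = (filled f).ncard + m := by
  rw [← Set.ncard_sdiff_add_ncard_of_subset (filled_subset_filled_step (f := f))
    (finite_filled_step hf), (ncard_new_step hf).2, add_comm]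

/-- If there are more vacant positions in `[p, p')` and unused numbers in `(-q', -q]` than new
entries, then the new entries stay away from the corner `(p', -q')`. -/
theorem step_avoids_corner (hf : (filled f).Finite) {p' q' : ℤ} (hq : q ≤ q')
    (hm : m < vacantBefore f p p' + unusedCount f (-q') (-q))
    (h : f z = none) (hx : step f m p q z = some x) :
    (z < p' ∨ -q' + 1 < x) ∧ (z + 1 < p' ∨ -q' < x) := by
  obtain ⟨h1, h2, rfl⟩ := (step_eq_some_iff h).1 hx
  constructor
  · rw [or_iff_not_imp_left]
    intro hz
    have h3 := vacantBefore_mono f p (not_lt.1 hz)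
    -- The next smaller unused value still exceeds `-q'`; this gives the extra unit in the bound for
    -- the placed value.
    have h4 : -q' < unusedBelow f (-q) (m - 1 - vacantBefore f p z + 1) :=
      lt_unusedBelow_of_lt_unusedCount (by omega) (by omega)
    have h5 := unusedBelow_strictAnti hf (-q) (Nat.lt_succ_self (m - 1 - vacantBefore f p z))
    rw [Nat.succ_eq_add_one] at h5
    omega
  · rw [or_iff_not_imp_left]
    intro hz
    have h3 := vacantBefore_mono f p (not_lt.1 hz)
    have h4 : vacantBefore f p (z + 1) ≤ vacantBefore f p z + 1 := by
      rw [vacantBefore, vacantBefore, ← Finset.insert_Ico_right_eq_Ico_add_one h1,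
        Finset.filter_insert, if_pos h]
      exact Finset.card_insert_le _ _
    exact lt_unusedBelow_of_lt_unusedCount (by omega) (by omega)

end Step

end ThetaData

/-! ### Indexing, and the filling after several steps -/

namespace ThetaData

theorem K_succ (τ : ThetaData) (i : Fin τ.s) : τ.K (i + 1) = τ.k i := by
  have := i.2
  rw [K, dif_pos (by omega)]
  rfl

theorem P_succ (τ : ThetaData) (i : Fin τ.s) : τ.P (i + 1) = τ.p i := by
  have := i.2
  rw [P, dif_pos (by omega)]
  rfl

theorem Q_succ (τ : ThetaData) (i : Fin τ.s) : τ.Q (i + 1) = τ.q i := by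
  have := i.2
  rw [Q, dif_pos (by omega)]
  rfl

theorem K_zero (τ : ThetaData) : τ.K 0 = 0 := by simp [K]

variable {τ : ThetaData} {i j : ℕ}

theorem exists_fin (hi : 1 ≤ i) (his : i ≤ τ.s) : ∃ c : Fin τ.s, i = c + 1 :=
  ⟨⟨i - 1, by omega⟩, by simp; omega⟩

theorem one_le_a (τ : ThetaData) : 1 ≤ τ.a := by simp [a]

theorem a_le (τ : ThetaData) : τ.a ≤ τ.s + 1 := by
  have := Nat.findGreatest_le (P := fun j => 0 < τ.Q j) τ.s
  simpa [a] using this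

theorem R_le (τ : ThetaData) (i : ℕ) : τ.R i ≤ τ.s := Nat.findGreatest_le _

theorem neg_Q_lt_Q_R (h : τ.R i ≠ 0) : -τ.Q i < τ.Q (τ.R i) :=
  Nat.findGreatest_of_ne_zero (P := fun j => -τ.Q i < τ.Q j) rfl h

namespace IsThetaTriple

theorem K_lt (hτ : τ.IsThetaTriple) (hij : i < j) (hj : j ≤ τ.s) : τ.K i < τ.K j := by
  obtain ⟨c, rfl⟩ := exists_fin (by omega) hj
  rw [K_succ]
  rcases Nat.eq_zero_or_pos i with rfl | hi
  · rw [K_zero]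
    exact hτ.k_pos c
  · obtain ⟨d, rfl⟩ := exists_fin (τ := τ) hi (by omega)
    rw [K_succ]
    exact hτ.k_strictMono (by rw [Fin.lt_def]; omega)

theorem K_le (hτ : τ.IsThetaTriple) (hij : i ≤ j) (hj : j ≤ τ.s) : τ.K i ≤ τ.K j := by
  rcases hij.eq_or_lt with rfl | h
  · exact le_rfl
  · exact (hτ.K_lt h hj).le

theorem P_le (hτ : τ.IsThetaTriple) (hi : 1 ≤ i) (hij : i ≤ j) (hj : j ≤ τ.s) :
    τ.P j ≤ τ.P i := by
  obtain ⟨c, rfl⟩ := exists_fin (by omega) hj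
  obtain ⟨d, rfl⟩ := exists_fin (τ := τ) hi (by omega)
  rw [P_succ, P_succ]
  exact hτ.p_antitone (by rw [Fin.le_def]; omega)

theorem P_pos (hτ : τ.IsThetaTriple) (hi : 1 ≤ i) (his : i ≤ τ.s) : 0 < τ.P i := by
  obtain ⟨d, rfl⟩ := exists_fin (τ := τ) hi his
  rw [P_succ]
  exact hτ.p_pos d

theorem Q_le (hτ : τ.IsThetaTriple) (hi : 1 ≤ i) (hij : i ≤ j) (hj : j ≤ τ.s) :
    τ.Q j ≤ τ.Q i := by
  obtain ⟨c, rfl⟩ := exists_fin (by omega) hj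
  obtain ⟨d, rfl⟩ := exists_fin (τ := τ) hi (by omega)
  rw [Q_succ, Q_succ]
  exact hτ.q_antitone (by rw [Fin.le_def]; omega)

theorem Q_ne_zero (hτ : τ.IsThetaTriple) (hi : 1 ≤ i) (his : i ≤ τ.s) : τ.Q i ≠ 0 := by
  obtain ⟨d, rfl⟩ := exists_fin (τ := τ) hi his
  rw [Q_succ]
  exact hτ.A1 d

theorem Q_pos (hτ : τ.IsThetaTriple) (hi : 1 ≤ i) (hia : i < τ.a) : 0 < τ.Q i := by
  have h1 : Nat.findGreatest (fun j => 0 < τ.Q j) τ.s = τ.a - 1 := by simp [a]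
  have h2 : 0 < τ.Q (τ.a - 1) :=
    Nat.findGreatest_of_ne_zero (P := fun j => 0 < τ.Q j) h1 (by omega)
  have := a_le τ
  exact h2.trans_le (hτ.Q_le hi (by omega) (by omega))

theorem Q_neg (hτ : τ.IsThetaTriple) (hi : τ.a ≤ i) (his : i ≤ τ.s) : τ.Q i < 0 := by
  have h1 : ¬ 0 < τ.Q i :=
    Nat.findGreatest_is_greatest (P := fun j => 0 < τ.Q j) (n := τ.s) (by rw [a] at hi; omega) his
  have := hτ.Q_ne_zero ((one_le_a τ).trans hi) his
  omega

theorem R_lt_a (hτ : τ.IsThetaTriple) (hi : τ.a ≤ i) (his : i ≤ τ.s) : τ.R i < τ.a := by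
  rcases Nat.eq_zero_or_pos (τ.R i) with h | h
  · rw [h]; exact one_le_a τ
  · by_contra! h1
    have h2 := hτ.Q_neg h1 (R_le τ i)
    have h3 := neg_Q_lt_Q_R h.ne'
    have h4 := hτ.Q_neg hi his
    omega

theorem R_le_R (hτ : τ.IsThetaTriple) (hi : 1 ≤ i) (hij : i ≤ j) (hj : j ≤ τ.s) :
    τ.R j ≤ τ.R i := by
  refine Nat.findGreatest_mono_left (fun c hc => ?_) _
  have := hτ.Q_le hi hij hj
  omega

end IsThetaTriple

/-- The position `z` receives the entry `x` in Step `(i + 1)`. -/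
def New (τ : ThetaData) (i : ℕ) (z x : ℤ) : Prop :=
  τ.fill i z = none ∧ τ.fill (i + 1) z = some x

theorem finite_filled_fill (τ : ThetaData) (i : ℕ) : (filled (τ.fill i)).Finite := by
  induction i with
  | zero => simp [filled, fill]
  | succ i ih => exact finite_filled_step ih

theorem fill_mono {z x : ℤ} (hij : i ≤ j) (h : τ.fill i z = some x) : τ.fill j z = some x := by
  induction j, hij using Nat.le_induction with
  | base => exact h
  | succ j _ ih => exact step_of_eq_some ih

theorem fill_eq_none {z : ℤ} (hij : i ≤ j) (h : τ.fill j z = none) : τ.fill i z = none := by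
  rcases hz : τ.fill i z with _ | x
  · rfl
  · rw [fill_mono hij hz] at h
    cases h

theorem exists_new {z x : ℤ} (hi : τ.fill i z = none) (hj : τ.fill j z = some x) :
    ∃ l, i ≤ l ∧ l < j ∧ τ.New l z x := by
  induction j with
  | zero => simp [fill] at hj
  | succ j ih =>
    rcases hz : τ.fill j z with _ | y
    · refine ⟨j, ?_, by omega, hz, hj⟩
      by_contra! h
      rw [fill_eq_none h hi] at hj
      cases hj
    · have h1 := fill_mono (Nat.le_succ j) hz
      rw [Nat.succ_eq_add_one, hj] at h1
      cases h1
      obtain ⟨l, h1, h2, h3⟩ := ih hz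
      exact ⟨l, h1, by omega, h3⟩

namespace New

variable {l : ℕ} {z x : ℤ}

theorem pos_ge (h : τ.New l z x) : τ.P (l + 1) ≤ z := step_pos_ge h.1 h.2

theorem val_le (h : τ.New l z x) : x ≤ -τ.Q (l + 1) := step_val_le h.1 h.2

theorem unused (h : τ.New l z x) : Unused (τ.fill l) x :=
  step_val_unused (finite_filled_fill τ l) h.1 h.2

end New

theorem fill_ne_zero {z x : ℤ} (h : τ.fill i z = some x) : x ≠ 0 := by
  obtain ⟨l, -, -, hl⟩ := exists_new (i := 0) rfl h
  exact hl.unused.1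

theorem entry_of_fill {z x : ℤ} (h : τ.fill i z = some x) (hi : i ≤ τ.s) : τ.entry z = x := by
  rw [entry, fill_mono hi h]

theorem w_of_fill {z x : ℤ} (h : τ.fill i z = some x) (hi : i ≤ τ.s) (hz : 0 < z) :
    τ.w z = x := by
  rw [w, if_pos hz, entry_of_fill h hi]

theorem w_zero (τ : ThetaData) : τ.w 0 = 0 := by simp [w]

theorem w_of_vacant {z : ℤ} (h : τ.fill τ.s z = none) (hz : 0 < z) :
    ∃ x : ℕ, τ.w z = x ∧ Unused (τ.fill τ.s) x ∧
      Nat.nth (fun x : ℕ => Unused (τ.fill τ.s) x) (vacantBefore (τ.fill τ.s) 1 z) = x := by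
  refine ⟨_, ?_, Nat.nth_mem_of_infinite (infinite_unused_nat (finite_filled_fill τ τ.s)) _, rfl⟩
  rw [w, if_pos hz, entry, h]

theorem w_pos_of_vacant {z : ℤ} (h : τ.fill τ.s z = none) (hz : 0 < z) : 0 < τ.w z := by
  obtain ⟨x, hx, hu, -⟩ := w_of_vacant h hz
  have := hu.1
  omega

theorem w_ne_zero {z : ℤ} (hz : 0 < z) : τ.w z ≠ 0 := by
  rcases h : τ.fill τ.s z with _ | x
  · exact (w_pos_of_vacant h hz).ne'
  · rw [w_of_fill h le_rfl hz]
    exact fill_ne_zero h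

theorem w_strictMono_of_vacant {z z' : ℤ} (h : τ.fill τ.s z = none)
    (h' : τ.fill τ.s z' = none) (hz : 0 < z) (hzz : z < z') : τ.w z < τ.w z' := by
  obtain ⟨x, hx, -, rfl⟩ := w_of_vacant h hz
  obtain ⟨y, hy, -, rfl⟩ := w_of_vacant h' (hz.trans hzz)
  rw [hx, hy]
  exact_mod_cast Nat.nth_strictMono (infinite_unused_nat (finite_filled_fill τ τ.s))
    (vacantBefore_lt (by omega) hzz h)

namespace IsThetaTriple

variable {z z' x x' : ℤ}

theorem pos_ge_of_fill (hτ : τ.IsThetaTriple) (his : i ≤ τ.s) (h : τ.fill i z = some x) :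
    τ.P i ≤ z := by
  obtain ⟨l, -, h2, h3⟩ := exists_new (i := 0) rfl h
  exact (hτ.P_le (by omega) h2 his).trans h3.pos_ge

theorem val_le_of_fill (hτ : τ.IsThetaTriple) (his : i ≤ τ.s) (h : τ.fill i z = some x) :
    x ≤ -τ.Q i := by
  obtain ⟨l, -, h2, h3⟩ := exists_new (i := 0) rfl h
  have : τ.Q i ≤ τ.Q (l + 1) := hτ.Q_le (by omega) h2 his
  have := h3.val_le
  omega

theorem pos_of_fill (hτ : τ.IsThetaTriple) (his : i ≤ τ.s) (h : τ.fill i z = some x) : 0 < z := by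
  obtain ⟨l, -, h2, h3⟩ := exists_new (i := 0) rfl h
  exact (hτ.P_pos (by omega) (by omega)).trans_le h3.pos_ge

theorem ncard_filled (hτ : τ.IsThetaTriple) (his : i ≤ τ.s) :
    ((filled (τ.fill i)).ncard : ℤ) = τ.K i := by
  induction i with
  | zero => simp [filled, fill, K_zero]
  | succ i ih =>
    have h1 := hτ.K_lt (Nat.lt_succ_self i) his
    rw [Nat.succ_eq_add_one] at h1
    rw [fill, ncard_filled_step (finite_filled_fill τ i)]
    push_cast
    rw [ih (by omega)]
    omega

theorem filled_subset (τ : ThetaData) (hij : i ≤ j) : filled (τ.fill i) ⊆ filled (τ.fill j) := by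
  intro z hz h
  exact hz (fill_eq_none hij h)

theorem ncard_filled_diff (hτ : τ.IsThetaTriple) (hij : i ≤ j) (hj : j ≤ τ.s) :
    ((filled (τ.fill j) \ filled (τ.fill i)).ncard : ℤ) = τ.K j - τ.K i := by
  have := Set.ncard_sdiff_add_ncard_of_subset (filled_subset τ hij) (finite_filled_fill τ j)
  rw [← hτ.ncard_filled hj, ← hτ.ncard_filled (hij.trans hj)]
  omega

/-- If all entries with absolute value in `(c, b]` are placed in Steps `(i + 1), …, (j)`, at least
`b - c - (K j - K i)` numbers in `(c, b]` are unused. -/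
theorem le_unusedCount (hτ : τ.IsThetaTriple) (hij : i ≤ j) (hj : j ≤ τ.s) {l : ℕ} {c b : ℤ}
    (h0 : 0 ≤ c)
    (h : ∀ z x, τ.fill l z = some x → c < |x| → |x| ≤ b →
      τ.fill i z = none ∧ τ.fill j z = some x) :
    b - c - (τ.K j - τ.K i) ≤ unusedCount (τ.fill l) c b := by
  -- Each value is unused or blocked by an entry of the given steps. The default 0 never matters,
  -- since only filled positions are taken.
  have h1 : Set.Ioc c b ⊆ {v | c < v ∧ v ≤ b ∧ Unused (τ.fill l) v} ∪
      (fun z => |(τ.fill j z).getD 0|) '' (filled (τ.fill j) \ filled (τ.fill i)) := by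
    intro v hv
    by_cases hu : Unused (τ.fill l) v
    · exact Or.inl ⟨hv.1, hv.2, hu⟩
    · right
      have hv0 : v ≠ 0 := by have := hv.1; omega
      simp only [Unused, not_and, not_forall, not_not] at hu
      obtain ⟨z, x, hx, hxv⟩ := hu hv0
      rw [abs_of_pos (h0.trans_lt hv.1)] at hxv
      obtain ⟨h2, h3⟩ := h z x hx (hxv ▸ hv.1) (hxv ▸ hv.2)
      exact ⟨z, ⟨by simp [filled, h3], by simp [filled, h2]⟩, by simp [h3, hxv]⟩
  have hfin : (filled (τ.fill j) \ filled (τ.fill i)).Finite :=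
    (finite_filled_fill τ j).subset Set.sdiff_subset
  have h2 := (Set.ncard_le_ncard h1 ((finite_unused_Ioc _ _ _).union (hfin.image _))).trans
    (Set.ncard_union_le _ _)
  have h3 := Set.ncard_image_le (f := fun z => |(τ.fill j z).getD 0|) hfin
  have h4 := hτ.ncard_filled_diff hij hj
  have h5 : (Set.Ioc c b).ncard = (b - c).toNat := by
    rw [Set.ncard_eq_toFinset_card', Set.toFinset_Ioc, Int.card_Ioc]
  rw [h5] at h2
  rw [unusedCount]
  omega

end IsThetaTriple

end ThetaData

/-! ### Signs of the entries, and the region filled by the first steps -/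

namespace ThetaData
variable {τ : ThetaData} {i j l : ℕ} {z z' x x' : ℤ}

theorem fill_unique (h : τ.fill i z = some x) (h' : τ.fill j z = some x') : x = x' := by
  have h1 := fill_mono (le_max_left i j) h
  rw [fill_mono (le_max_right i j) h'] at h1
  exact (Option.some.inj h1).symm

theorem unusedCount_of_forall {f : Filling} {c b : ℤ} (h : ∀ v, c < v → v ≤ b → Unused f v) :
    unusedCount f c b = (b - c).toNat := by
  have h1 : {v | c < v ∧ v ≤ b ∧ Unused f v} = Set.Ioc c b := by
    ext v
    exact ⟨fun hv => ⟨hv.1, hv.2.1⟩, fun hv => ⟨hv.1, hv.2, h v hv.1 hv.2⟩⟩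
  rw [unusedCount, h1, Set.ncard_eq_toFinset_card', Set.toFinset_Ioc, Int.card_Ioc]

theorem count_unused_nat (f : Filling) (n : ℕ) [DecidablePred fun x : ℕ => Unused f x] :
    Nat.count (fun x : ℕ => Unused f x) (n + 1) = unusedCount f 0 n := by
  rw [Nat.count_eq_card_filter_range, unusedCount, ← Set.ncard_coe_finset]
  refine Set.ncard_congr (fun (d : ℕ) _ => (d : ℤ)) ?_ ?_ ?_
  · intro d hd
    simp only [Finset.coe_filter, Finset.mem_range, Set.mem_ofPred_eq] at hd ⊢
    have := hd.2.1
    exact ⟨by omega, by omega, hd.2⟩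
  · intro d d' _ _ h
    simpa using h
  · intro v hv
    simp only [Finset.coe_filter, Finset.mem_range, Set.mem_ofPred_eq] at hv ⊢
    obtain ⟨d, rfl⟩ := Int.eq_ofNat_of_zero_le hv.1.le
    exact ⟨d, ⟨by omega, hv.2.2⟩, rfl⟩

namespace IsThetaTriple

/-- These entries are at most `-q_{R(i)} < q_i`. For negative `q_i` they therefore block no value in
`(0, -q_i]`. -/
theorem lt_Q_of_fill_R (hτ : τ.IsThetaTriple) (h : τ.fill (τ.R i) z = some x) : x < τ.Q i := by
  have h0 : τ.R i ≠ 0 := by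
    intro h0
    simp [h0, fill] at h
  have h1 := neg_Q_lt_Q_R h0
  have h2 := hτ.val_le_of_fill (R_le τ i) h
  omega

theorem neg_of_fill (hτ : τ.IsThetaTriple) (hi : i < τ.a) (h : τ.fill i z = some x) : x < 0 := by
  have h1 := a_le τ
  have h2 := hτ.val_le_of_fill (by omega) h
  have h0 : 1 ≤ i := by
    rw [Nat.one_le_iff_ne_zero]
    rintro rfl
    simp [fill] at h
  have := hτ.Q_pos h0 hi
  omega

/-- Values in `(0, -q_{l+1}]` are blocked only by Steps (R(l+1)+1), …, (l), so C1 leaves enough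
unused positive values for the whole step. -/
theorem pos_of_new (hτ : τ.IsThetaTriple) (hl : τ.a ≤ l + 1) (hs : l + 1 ≤ τ.s)
    (h : τ.New l z x) : 0 < x := by
  obtain ⟨-, h1, rfl⟩ := (step_eq_some_iff h.1).1 h.2
  have hR := hτ.R_lt_a hl hs
  have h2 := hτ.le_unusedCount (i := τ.R (l + 1)) (j := l) (l := l) (c := 0)
    (b := -τ.Q (l + 1)) (by omega) (by omega) le_rfl (by
      intro z x hx _ hxb
      refine ⟨?_, hx⟩
      rcases hz : τ.fill (τ.R (l + 1)) z with _ | y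
      · rfl
      · have := fill_unique hz hx
        subst this
        have := hτ.lt_Q_of_fill_R hz
        have := neg_abs_le y
        omega)
  have h3 := hτ.C1 (l + 1) hl hs
  have h4 := hτ.Q_neg hl hs
  exact lt_unusedBelow_of_lt_unusedCount (by omega) (by omega)

theorem fill_of_neg (hτ : τ.IsThetaTriple) (hi : i ≤ τ.s) (h : τ.fill i z = some x)
    (hx : x < 0) : τ.fill (τ.a - 1) z = some x := by
  rcases hz : τ.fill (τ.a - 1) z with _ | y
  · obtain ⟨l, h1, h2, h3⟩ := exists_new hz h
    have := hτ.pos_of_new (by omega) (by omega) h3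
    omega
  · rw [fill_unique h hz]

theorem abs_injective (hτ : τ.IsThetaTriple) (hi : i ≤ τ.s) (h : τ.fill i z = some x)
    (h' : τ.fill i z' = some x') (hx : |x| = |x'|) : z = z' := by
  obtain ⟨l, -, h1, h2⟩ := exists_new (i := 0) rfl h
  obtain ⟨l', -, h3, h4⟩ := exists_new (i := 0) rfl h'
  rcases lt_trichotomy l l' with hl | rfl | hl
  · exact absurd hx (h4.unused.2 _ _ (fill_mono (by omega : l + 1 ≤ l') h2.2))
  -- All entries of one step have the same sign, so equal absolute values mean equal entries.
  · have hxx : x = x' := by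
      rcases lt_or_ge (l + 1) τ.a with ha | ha
      · have := hτ.neg_of_fill ha h2.2
        have := hτ.neg_of_fill ha h4.2
        rw [abs_of_neg ‹_›, abs_of_neg ‹_›] at hx
        omega
      · have := hτ.pos_of_new ha (by omega) h2
        have := hτ.pos_of_new ha (by omega) h4
        rw [abs_of_pos ‹_›, abs_of_pos ‹_›] at hx
        omega
    have hf := finite_filled_fill τ l
    rcases lt_trichotomy z z' with hz | hz | hz
    · exact absurd hxx (step_strictMono hf h2.1 h2.2 h4.1 h4.2 hz).ne
    · exact hz
    · exact absurd hxx.symm (step_strictMono hf h4.1 h4.2 h2.1 h2.2 hz).ne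
  · exact absurd hx.symm (h2.unused.2 _ _ (fill_mono (by omega : l' + 1 ≤ l) h4.2))

/-- This turns B1 and B2 into the count needed by `step_avoids_corner`. For negative q, C2 confines
the entries blocking `(-q_l, -q_{l+1}]` to Steps (R(l+1)+1), …, (R(l)), which explains the extra
term in B2. -/
theorem lt_unusedCount (hτ : τ.IsThetaTriple) (h1 : 1 ≤ l) (hs : l < τ.s) (ha : l + 1 ≠ τ.a) :
    τ.K (l + 1) - τ.K l <
      (τ.P l - τ.P (l + 1)) + unusedCount (τ.fill l) (-τ.Q l) (-τ.Q (l + 1)) := by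
  have hQ := hτ.Q_le h1 (Nat.le_succ l) hs
  rw [Nat.succ_eq_add_one] at hQ
  rcases lt_or_ge (l + 1) τ.a with hl | hl
  · have hB := hτ.B1 l h1 hl
    have hq := hτ.Q_pos (by omega) hl
    rw [unusedCount_of_forall]
    · omega
    · intro v hv hv'
      refine ⟨by omega, fun z y hy hyv => ?_⟩
      have h2 := hτ.val_le_of_fill hs.le hy
      rw [abs_of_neg (by omega), abs_of_neg (by omega)] at hyv
      omega
  · have hB := hτ.B2 l (by omega) hs
    have hq := hτ.Q_neg (by omega) hs.le
    have h2 := hτ.le_unusedCount (i := τ.R (l + 1)) (j := τ.R l) (l := l) (c := -τ.Q l)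
      (b := -τ.Q (l + 1)) (hτ.R_le_R h1 (Nat.le_succ l) hs) (R_le τ l) (by omega) (by
        intro z x hx hxc hxb
        constructor
        · rcases hz : τ.fill (τ.R (l + 1)) z with _ | y
          · rfl
          · have := fill_unique hz hx
            subst this
            have := hτ.lt_Q_of_fill_R hz
            have := neg_abs_le y
            omega
        · have hx0 : x < 0 := by
            by_contra! hx0
            rw [abs_of_nonneg hx0] at hxc
            have := hτ.val_le_of_fill hs.le hx
            omega
          rcases hz : τ.fill (τ.R l) z with _ | y
          · have := hτ.C2 l (by omega) hs.le z x hz (hτ.fill_of_neg hs.le hx hx0)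
            rw [abs_of_neg hx0] at hxc
            omega
          · rw [fill_unique hz hx])
    omega

theorem vacantBefore_fill (hτ : τ.IsThetaTriple) (hs : i ≤ τ.s) {p : ℤ} (hp : p ≤ τ.P i) :
    (vacantBefore (τ.fill i) p (τ.P i) : ℤ) = τ.P i - p := by
  refine vacantBefore_eq_of_forall hp fun y _ hy => ?_
  rcases hz : τ.fill i y with _ | x
  · rfl
  · have := hτ.pos_ge_of_fill hs hz
    omega

theorem new_avoids_corner (hτ : τ.IsThetaTriple) (h1 : 1 ≤ l) (hs : l < τ.s)
    (h : τ.New l z x) :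
    (z < τ.P l ∨ -τ.Q l + 1 < x) ∧ (z + 1 < τ.P l ∨ -τ.Q l < x) := by
  -- At the sign change no B-condition applies, but the new entry is positive while `-q_l + 1 ≤ 0`.
  by_cases ha : l + 1 = τ.a
  · have h2 := hτ.Q_pos h1 (by omega)
    have h3 := hτ.pos_of_new ha.ge hs h
    omega
  · refine step_avoids_corner (finite_filled_fill τ l) (hτ.Q_le h1 (Nat.le_succ l) hs) ?_ h.1 h.2
    have h2 := hτ.lt_unusedCount h1 hs ha
    have h3 := hτ.vacantBefore_fill hs.le (hτ.P_le h1 (Nat.le_succ l) hs)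
    have h4 := hτ.K_le (Nat.le_succ l) hs
    rw [Nat.succ_eq_add_one] at *
    omega

/-- The entries placed after Step (R(s)) have distinct absolute values, all in `(0, -q_s]` by C2, so
each removes a different value. -/
theorem unusedCount_le (hτ : τ.IsThetaTriple) (ha : τ.a ≤ τ.s) :
    (unusedCount (τ.fill τ.s) 0 (-τ.Q τ.s) : ℤ) ≤ -τ.Q τ.s - (τ.K τ.s - τ.K (τ.R τ.s)) := by
  set g : ℤ → ℤ := fun z => |(τ.fill τ.s z).getD 0| with hg
  set A := filled (τ.fill τ.s) \ filled (τ.fill (τ.R τ.s)) with hA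
  have hsome : ∀ z ∈ A, ∃ x, τ.fill τ.s z = some x := fun z hz =>
    Option.ne_none_iff_exists'.1 hz.1
  have hinj : Set.InjOn g A := by
    intro z hz z' hz' h
    obtain ⟨x, hx⟩ := hsome z hz
    obtain ⟨x', hx'⟩ := hsome z' hz'
    refine hτ.abs_injective le_rfl hx hx' ?_
    simpa [hg, hx, hx'] using h
  have hfin : A.Finite := (finite_filled_fill τ τ.s).subset Set.sdiff_subset
  have hdisj : Disjoint {v | 0 < v ∧ v ≤ -τ.Q τ.s ∧ Unused (τ.fill τ.s) v} (g '' A) := by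
    rw [Set.disjoint_left]
    rintro _ hv ⟨z, hz, rfl⟩
    obtain ⟨x, hx⟩ := hsome z hz
    exact hv.2.2.2 z x hx (by simp [hg, hx])
  have hsub : {v | 0 < v ∧ v ≤ -τ.Q τ.s ∧ Unused (τ.fill τ.s) v} ∪ g '' A ⊆
      Set.Ioc 0 (-τ.Q τ.s) := by
    rintro _ (hv | ⟨z, hz, rfl⟩)
    · exact ⟨hv.1, hv.2.1⟩
    · obtain ⟨x, hx⟩ := hsome z hz
      have hz' : τ.fill (τ.R τ.s) z = none := by simpa [filled] using hz.2
      simp only [hg, hx, Option.getD_some, Set.mem_Ioc, abs_pos]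
      refine ⟨fill_ne_zero hx, abs_le.2 ⟨?_, hτ.val_le_of_fill le_rfl hx⟩⟩
      rw [neg_neg]
      rcases lt_or_ge x 0 with hx0 | hx0
      · exact (hτ.C2 τ.s ha le_rfl z x hz' (hτ.fill_of_neg le_rfl hx hx0)).le
      · have := hτ.Q_neg ha le_rfl
        omega
  have h1 := Set.ncard_le_ncard hsub (Set.finite_Ioc _ _)
  rw [Set.ncard_union_eq hdisj (finite_unused_Ioc _ _ _) (hfin.image _), hinj.ncard_image,
    Set.ncard_eq_toFinset_card' (Set.Ioc _ _), Set.toFinset_Ioc, Int.card_Ioc] at h1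
  have h2 := hτ.ncard_filled_diff (R_le τ τ.s) le_rfl
  rw [← hA] at h2
  have h3 := hτ.Q_neg ha le_rfl
  rw [unusedCount]
  omega

/-- By B3 the `p_s - 1` vacant positions before `p_s` outnumber the unused positive values up to
`-q_s`, so the final step exhausts these values before reaching `p_s`. -/
theorem vacant_avoids_corner (hτ : τ.IsThetaTriple) (hs : 1 ≤ τ.s) (hz : 0 < z)
    (h : τ.fill τ.s z = none) :
    (z < τ.P τ.s ∨ -τ.Q τ.s + 1 < τ.w z) ∧ (z + 1 < τ.P τ.s ∨ -τ.Q τ.s < τ.w z) := by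
  classical
  rcases lt_or_ge τ.s τ.a with ha | ha
  · have h1 := hτ.Q_pos hs ha
    have h2 := w_pos_of_vacant h hz
    omega
  · obtain ⟨y, hy, -, hn⟩ := w_of_vacant h hz
    have hB := hτ.B3 ha
    have hU := hτ.unusedCount_le ha
    have hQ := hτ.Q_neg ha le_rfl
    have hP := hτ.P_pos hs le_rfl
    have hV := hτ.vacantBefore_fill le_rfl (p := 1) (by omega)
    obtain ⟨n, hn'⟩ := Int.eq_ofNat_of_zero_le (by omega : 0 ≤ -τ.Q τ.s)
    rw [hn', ← count_unused_nat] at hU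
    have hinf := infinite_unused_nat (finite_filled_fill τ τ.s)
    have key : ∀ t, Nat.count (fun x : ℕ => Unused (τ.fill τ.s) x) (n + 1) ≤ t →
        n + 1 ≤ Nat.nth (fun x : ℕ => Unused (τ.fill τ.s) x) t := by
      intro t ht
      by_contra! hlt
      exact absurd ((Nat.lt_nth_iff_count_lt hinf).2 hlt) (by omega)
    rw [hy, hn', or_iff_not_imp_left, or_iff_not_imp_left]
    constructor
    · intro hzP
      have h1 := vacantBefore_mono (τ.fill τ.s) 1 (not_lt.1 hzP)
      have h2 := key (vacantBefore (τ.fill τ.s) 1 z - 1) (by omega)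
      have h3 := Nat.nth_strictMono hinf
        (show vacantBefore (τ.fill τ.s) 1 z - 1 < vacantBefore (τ.fill τ.s) 1 z by omega)
      omega
    · intro hzP
      have h1 := vacantBefore_mono (τ.fill τ.s) 1 (not_lt.1 hzP)
      have h4 : vacantBefore (τ.fill τ.s) 1 (z + 1) ≤ vacantBefore (τ.fill τ.s) 1 z + 1 := by
        rw [vacantBefore, vacantBefore, ← Finset.insert_Ico_right_eq_Ico_add_one (by omega),
          Finset.filter_insert, if_pos h]
        exact Finset.card_insert_le _ _
      have h2 := key (vacantBefore (τ.fill τ.s) 1 z) (by omega)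
      omega

/-- Entries placed after Step `(i)` stay away from the corner `(p_i, -q_i)`. -/
theorem later_avoids_corner (hτ : τ.IsThetaTriple) (hi : 1 ≤ i) (his : i ≤ τ.s) (hz : 0 < z)
    (h : τ.fill i z = none) :
    (z < τ.P i ∨ -τ.Q i + 1 < τ.w z) ∧ (z + 1 < τ.P i ∨ -τ.Q i < τ.w z) := by
  rcases hx : τ.fill τ.s z with _ | x
  · have h1 := hτ.vacant_avoids_corner (hi.trans his) hz hx
    have h2 := hτ.P_le hi his le_rfl
    have h3 := hτ.Q_le hi his le_rfl
    omega
  · rw [w_of_fill hx le_rfl hz]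
    obtain ⟨l, h1, h2, h3⟩ := exists_new h hx
    have h4 := hτ.new_avoids_corner (hi.trans h1) h2 h3
    have h5 := hτ.P_le hi h1 h2.le
    have h6 := hτ.Q_le hi h1 h2.le
    omega

theorem fill_of_mem_region (hτ : τ.IsThetaTriple) (hi : 1 ≤ i) (his : i ≤ τ.s)
    (hz : τ.P i ≤ z) (hw : τ.w z ≤ -τ.Q i) : τ.fill i z = some (τ.w z) := by
  have h0 := (hτ.P_pos hi his).trans_le hz
  rcases h : τ.fill i z with _ | x
  · have := (hτ.later_avoids_corner hi his h0 h).1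
    omega
  · rw [w_of_fill h his h0]

theorem filled_eq (hτ : τ.IsThetaTriple) (hi : 1 ≤ i) (his : i ≤ τ.s) :
    filled (τ.fill i) = {z | τ.P i ≤ z ∧ τ.w z ≤ -τ.Q i} := by
  ext z
  constructor
  · intro hz
    obtain ⟨x, hx⟩ := Option.ne_none_iff_exists'.1 hz
    rw [Set.mem_ofPred_eq, w_of_fill hx his (hτ.pos_of_fill his hx)]
    exact ⟨hτ.pos_ge_of_fill his hx, hτ.val_le_of_fill his hx⟩
  · intro hz
    have := hτ.fill_of_mem_region hi his hz.1 hz.2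
    simp [filled, this]

theorem K_eq (hτ : τ.IsThetaTriple) (hi : 1 ≤ i) (his : i ≤ τ.s) :
    τ.K i = ({z | τ.P i ≤ z ∧ τ.w z ≤ -τ.Q i}.ncard : ℤ) := by
  rw [← hτ.filled_eq hi his, hτ.ncard_filled his]

end IsThetaTriple

end ThetaData

/-! ### Corners of the signed permutation -/

namespace ThetaData

/-- The diagram of `u` has a corner at `(p, q)`: `p` is a descent of `u` and `-q` is a descent of
its inverse, both seen from the region of positions `≥ p` with values `≤ -q`. -/
structure IsCorner (u : ℤ → ℤ) (p q : ℤ) : Prop where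
  pos : 0 < p
  le : u p ≤ -q
  lt : -q < u (p - 1)
  exists_eq : ∃ z, p ≤ z ∧ u z = -q
  ne : ∀ z, p ≤ z → u z ≠ -q + 1

namespace IsThetaTriple

variable {τ τ' : ThetaData} {i j : ℕ} {z x p q : ℤ}

/-- If `-q_{i+1}` is still unused, the step places it first. Otherwise it has been placed already,
since the opposite entry `q_{i+1}` is impossible: by sign if `q_{i+1} > 0`, by the choice of R and
C2 if `q_{i+1} < 0`. -/
theorem exists_fill_eq_neg_Q (hτ : τ.IsThetaTriple) (hs : i < τ.s) :
    ∃ z, τ.fill (i + 1) z = some (-τ.Q (i + 1)) := by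
  have hlt := hτ.K_lt (Nat.lt_succ_self i) hs
  rw [Nat.succ_eq_add_one] at hlt
  by_cases hu : Unused (τ.fill i) (-τ.Q (i + 1))
  · obtain ⟨z, -, hz⟩ := exists_step_eq_neg (m := (τ.K (i + 1) - τ.K i).toNat)
      (p := τ.P (i + 1)) (finite_filled_fill τ i) (by omega) hu
    exact ⟨z, hz⟩
  · have h0 : τ.Q (i + 1) ≠ 0 := hτ.Q_ne_zero (by omega) hs
    simp only [Unused, not_and, not_forall, not_not, abs_neg] at hu
    obtain ⟨z, y, hy, hyv⟩ := hu (by omega)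
    refine ⟨z, ?_⟩
    rcases abs_eq_abs.1 hyv with rfl | rfl
    · exfalso
      rcases lt_or_ge (i + 1) τ.a with ha | ha
      · have h1 := hτ.neg_of_fill (by omega) hy
        have h2 := hτ.Q_pos (by omega) ha
        omega
      · have h1 := hτ.Q_neg ha hs
        have h2 := hτ.fill_of_neg hs.le hy h1
        rcases hz : τ.fill (τ.R (i + 1)) z with _ | y
        · exact absurd (hτ.C2 (i + 1) ha hs z _ hz h2) (lt_irrefl _)
        · have h3 := hτ.lt_Q_of_fill_R hz
          have h4 := fill_unique hz h2
          omega
    · exact fill_mono (Nat.le_succ i) hy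

/-- Every pair `(p_i, q_i)` of a theta-triple is a corner. -/
theorem isCorner (hτ : τ.IsThetaTriple) (hi : 1 ≤ i) (his : i ≤ τ.s) :
    IsCorner τ.w (τ.P i) (τ.Q i) := by
  have hP := hτ.P_pos hi his
  obtain ⟨l, rfl⟩ := Nat.exists_eq_add_of_le' hi
  refine ⟨hP, ?_, ?_, ?_, ?_⟩
  · have hlt := hτ.K_lt (Nat.lt_succ_self l) his
    rw [Nat.succ_eq_add_one] at hlt
    obtain ⟨x, hx⟩ := Option.ne_none_iff_exists'.1
      (step_start_ne_none (f := τ.fill l) (m := (τ.K (l + 1) - τ.K l).toNat)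
        (p := τ.P (l + 1)) (q := τ.Q (l + 1)) (by omega))
    have hx' : τ.fill (l + 1) (τ.P (l + 1)) = some x := hx
    rw [w_of_fill hx' his hP]
    exact hτ.val_le_of_fill his hx'
  · rcases (Int.add_one_le_of_lt hP).lt_or_eq with h | h
    · have hn : τ.fill (l + 1) (τ.P (l + 1) - 1) = none := by
        rcases hz : τ.fill (l + 1) (τ.P (l + 1) - 1) with _ | y
        · rfl
        · have := hτ.pos_ge_of_fill his hz
          omega
      have := (hτ.later_avoids_corner hi his (by omega) hn).2
      omega
    -- For `p_i = 1` the position to the left is 0, with value 0, and A3 rules out a negative `q_i`.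
    · rw [← h, show (0 : ℤ) + 1 - 1 = 0 by norm_num, w_zero]
      have h1 := hτ.Q_ne_zero hi his
      by_contra! hq
      have h2 := hτ.Q_le hi his le_rfl
      have h3 := hτ.P_le hi his le_rfl
      have := hτ.A3 (by omega)
      omega
  · obtain ⟨z, hz⟩ := hτ.exists_fill_eq_neg_Q his
    exact ⟨z, hτ.pos_ge_of_fill his hz, w_of_fill hz his (hτ.pos_of_fill his hz)⟩
  · intro z hz hw
    rcases hx : τ.fill (l + 1) z with _ | x
    · have := (hτ.later_avoids_corner hi his (by omega) hx).1
      omega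
    · have := hτ.val_le_of_fill his hx
      rw [w_of_fill hx his (by omega)] at hw
      omega

/-- If the region of a corner is contained in none of the regions of Steps `(1), …, (i)`, these
steps do not fill it. -/
theorem exists_vacant_of_isCorner (hτ : τ.IsThetaTriple) (his : i ≤ τ.s)
    (hc : IsCorner τ.w p q)
    (h : ∀ j, 1 ≤ j → j ≤ i → ¬ (τ.P j ≤ p ∧ τ.Q j ≤ q)) :
    ∃ z, p ≤ z ∧ τ.w z ≤ -q ∧ τ.fill i z = none := by
  have hp := hc.pos
  obtain ⟨z, hz, hzq⟩ := hc.exists_eq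
  rcases hx : τ.fill i p with _ | x
  · exact ⟨p, le_rfl, hc.le, hx⟩
  · rcases hy : τ.fill i z with _ | y
    · exact ⟨z, hz, hzq.le, hy⟩
    · exfalso
      -- The later of the steps filling `p` and `z` has a region containing the whole region of the
      -- corner.
      obtain ⟨l, -, h1, h2⟩ := exists_new (i := 0) rfl hx
      obtain ⟨l', -, h3, h4⟩ := exists_new (i := 0) rfl hy
      rw [w_of_fill hy his (by omega)] at hzq
      have h5 := h2.pos_ge
      have h6 := h4.val_le
      have h7 := h (l + 1) (by omega) (by omega)
      have h8 := h (l' + 1) (by omega) (by omega)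
      rcases le_or_gt l' l with hl | hl
      · have := hτ.Q_le (i := l' + 1) (j := l + 1) (by omega) (by omega) (by omega)
        omega
      · have := hτ.P_le (i := l + 1) (j := l' + 1) (by omega) (by omega) (by omega)
        omega

/-- Otherwise the final step puts a value `≤ -q` at some position `≥ p`. That step is increasing, so
the larger value at `p - 1` comes from an earlier step, whose region then contains the corner. -/
theorem exists_region_of_isCorner (hτ : τ.IsThetaTriple) (hc : IsCorner τ.w p q) :
    ∃ j, 1 ≤ j ∧ j ≤ τ.s ∧ τ.P j ≤ p ∧ τ.Q j ≤ q := by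
  by_contra! hno
  obtain ⟨z, hz, hzq, hv⟩ := hτ.exists_vacant_of_isCorner le_rfl hc
    (fun j h1 h2 h3 => absurd (hno j h1 h2 h3.1) (not_lt.2 h3.2))
  have hp := hc.pos
  have hlt := hc.lt
  have hw := w_pos_of_vacant hv (by omega)
  rcases (Int.add_one_le_of_lt hp).lt_or_eq with h | h
  · rcases hx : τ.fill τ.s (p - 1) with _ | x
    · have := w_strictMono_of_vacant hx hv (by omega) (by omega)
      omega
    · obtain ⟨l, -, h1, h2⟩ := exists_new (i := 0) rfl hx
      rw [w_of_fill hx le_rfl (by omega)] at hlt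
      have h3 := h2.pos_ge
      have h4 := h2.val_le
      have := hno (l + 1) (by omega) (by omega) (by omega)
      omega
  · rw [← h, show (0 : ℤ) + 1 - 1 = 0 by norm_num, w_zero] at hlt
    omega

/-- Every corner either belongs to the theta-triple, or lies above a member at the same position
such that all the intermediate values are used, up to sign, at positions `≥ p`. -/
theorem exists_of_isCorner (hτ : τ.IsThetaTriple) (hc : IsCorner τ.w p q) :
    ∃ j, 1 ≤ j ∧ j ≤ τ.s ∧ τ.P j = p ∧ (τ.Q j = q ∨ (τ.Q j < q ∧ q < 0 ∧
      ∀ v, -q < v → v ≤ -τ.Q j → ∃ z, p ≤ z ∧ |τ.w z| = v)) := by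
  classical
  have hex := hτ.exists_region_of_isCorner hc
  -- The least index whose region contains the corner is the required one.
  obtain ⟨hj, hjs, hPj, hQj⟩ := Nat.find_spec hex
  have hmin : ∀ i, 1 ≤ i → i < Nat.find hex → ¬ (τ.P i ≤ p ∧ τ.Q i ≤ q) :=
    fun i h1 h2 h3 => Nat.find_min hex h2 ⟨h1, by omega, h3⟩
  obtain ⟨l, hl⟩ := Nat.exists_eq_add_of_le' hj
  rw [hl] at hj hjs hPj hQj hmin
  have hp := hc.pos
  have hlt := hc.lt
  obtain ⟨z, hz, hzq, hv⟩ := hτ.exists_vacant_of_isCorner (i := l) (by omega) hc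
    (fun j h1 h2 => hmin j h1 (by omega))
  have hzn : τ.New l z (τ.w z) := ⟨hv, hτ.fill_of_mem_region hj hjs (by omega) (by omega)⟩
  -- If `p_{l+1} < p`, then `p - 1` is filled by the end of this step. An earlier step contradicts
  -- minimality; the same step contradicts the descent at `p`, its entries being increasing.
  have hPp : τ.P (l + 1) = p := by
    by_contra hne
    have hP := hτ.P_pos hj hjs
    obtain ⟨y, hy⟩ := Option.ne_none_iff_exists'.1
      (step_leftmost (z' := p - 1) hzn.1 hzn.2 (by omega) (by omega))
    have hy' : τ.fill (l + 1) (p - 1) = some y := hy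
    rw [w_of_fill hy' hjs (by omega)] at hlt
    obtain ⟨l', -, h1, h2⟩ := exists_new (i := 0) rfl hy'
    have h3 := h2.pos_ge
    have h4 := h2.val_le
    rcases (Nat.lt_succ_iff.1 h1).lt_or_eq with h | rfl
    · exact hmin (l' + 1) (by omega) (by omega) (by omega)
    · have := step_strictMono (finite_filled_fill τ l') h2.1 h2.2 hzn.1 hzn.2 (by omega)
      omega
  have hused : ∀ v, v ≠ 0 → -q < v → v ≤ -τ.Q (l + 1) →
      ∃ z' y, τ.fill (l + 1) z' = some y ∧ |y| = |v| := by
    intro v hv0 hqv hvQ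
    by_cases hu : Unused (τ.fill l) v
    · obtain ⟨z', -, h'⟩ := step_topmost (finite_filled_fill τ l) hzn.1 hzn.2 (by omega) hvQ hu
      exact ⟨z', v, h', rfl⟩
    · simp only [Unused, not_and, not_forall, not_not] at hu
      obtain ⟨z', y, hy, hyv⟩ := hu hv0
      exact ⟨z', y, fill_mono (Nat.le_succ l) hy, hyv⟩
  refine ⟨l + 1, hj, hjs, hPp, ?_⟩
  rcases hQj.eq_or_lt with h | h
  · exact Or.inl h
  · have hq : q < 0 := by
      by_contra! hq0
      have hw0 := w_ne_zero (τ := τ) (z := z) (by omega)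
      rcases lt_or_ge (l + 1) τ.a with ha | ha
      · have hQ := hτ.Q_pos hj ha
        -- All entries so far are negative, so `-q + 1` itself occurs at a position `≥ p`, which a
        -- corner forbids.
        obtain ⟨z', y, hy, hyv⟩ := hused (-q + 1) (by omega) (by omega) (by omega)
        have hy0 := hτ.neg_of_fill ha hy
        rw [abs_of_neg hy0, abs_of_neg (by omega)] at hyv
        have h1 := hτ.pos_ge_of_fill hjs hy
        refine hc.ne z' (by omega) ?_
        rw [w_of_fill hy hjs (by omega)]
        omega
      · have := hτ.pos_of_new ha hjs hzn
        omega
    refine Or.inr ⟨h, hq, fun v h1 h2 => ?_⟩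
    obtain ⟨z', y, hy, hyv⟩ := hused v (by omega) h1 h2
    have h3 := hτ.pos_ge_of_fill hjs hy
    refine ⟨z', by omega, ?_⟩
    rw [w_of_fill hy hjs (by omega), hyv, abs_of_pos (by omega)]

/-- If `p_i = p_{i+1}` and `q_i < 0`, some value in `(-q_i, -q_{i+1}]` is not used, up to sign, at
positions `≥ p_i`. -/
theorem exists_unused_of_P_eq (hτ : τ.IsThetaTriple) (ha : τ.a ≤ i) (his : i < τ.s)
    (hP : τ.P (i + 1) = τ.P i) :
    ∃ v, -τ.Q i < v ∧ v ≤ -τ.Q (i + 1) ∧ ∀ z, τ.P i ≤ z → |τ.w z| ≠ v := by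
  have hi := (one_le_a τ).trans ha
  have hcount := hτ.lt_unusedCount hi his (by omega)
  have hQ := hτ.Q_neg ha his.le
  -- With `p_i = p_{i+1}` the count leaves more unused values in the interval than entries of Step
  -- (i+1), so one value is left over.
  have hex : ∃ v, -τ.Q i < v ∧ v ≤ -τ.Q (i + 1) ∧ Unused (τ.fill i) v ∧
      ∀ z, τ.fill i z = none → τ.fill (i + 1) z ≠ some v := by
    by_contra! hno
    have hsub : {v | -τ.Q i < v ∧ v ≤ -τ.Q (i + 1) ∧ Unused (τ.fill i) v} ⊆
        (fun z => (τ.fill (i + 1) z).getD 0) ''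
          (filled (τ.fill (i + 1)) \ filled (τ.fill i)) := by
      intro v hv
      obtain ⟨z, h1, h2⟩ := hno v hv.1 hv.2.1 hv.2.2
      exact ⟨z, ⟨by simp [filled, h2], by simp [filled, h1]⟩, by simp [h2]⟩
    have hfin : (filled (τ.fill (i + 1)) \ filled (τ.fill i)).Finite :=
      (finite_filled_fill τ (i + 1)).subset Set.sdiff_subset
    have h1 := (Set.ncard_le_ncard hsub (hfin.image _)).trans (Set.ncard_image_le hfin)
    have h2 := hτ.ncard_filled_diff (Nat.le_succ i) his
    rw [Nat.succ_eq_add_one] at h2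
    rw [unusedCount] at hcount
    omega
  obtain ⟨v, h1, h2, hu, hv⟩ := hex
  refine ⟨v, h1, h2, fun z hz hw => ?_⟩
  have hused : ∀ y, τ.fill i z = some y → |y| ≠ |v| := hu.2 z
  -- A later occurrence of `v` would lie in region i+1, one of `-v` in region i; both regions are
  -- already filled.
  rcases (abs_eq (by omega)).1 hw with h | h
  · have h3 := hτ.fill_of_mem_region (i := i + 1) (z := z) (by omega) his (by omega) (by omega)
    refine hv z ?_ (h ▸ h3)
    rcases hy : τ.fill i z with _ | y
    · rfl
    · have := fill_unique hy h3
      exact (hused y hy (by rw [this, h])).elim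
  · have h3 := hτ.fill_of_mem_region (i := i) hi his.le hz
      (by omega)
    exact hused _ h3 (by rw [h, abs_neg])

/-! ### Comparison of two triples -/

theorem exists_corner_eq (hτ : τ.IsThetaTriple) (hτ' : τ'.IsThetaTriple) (hw : τ.w = τ'.w)
    (hi : 1 ≤ i) (his : i ≤ τ.s) :
    ∃ j, 1 ≤ j ∧ j ≤ τ'.s ∧ τ'.P j = τ.P i ∧ τ'.Q j = τ.Q i := by
  obtain ⟨j, hj, hjs, hPj, hQ | ⟨hQ, hneg, hv⟩⟩ :=
    hτ'.exists_of_isCorner (hw ▸ hτ.isCorner hi his)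
  · exact ⟨j, hj, hjs, hPj, hQ⟩
  · exfalso
    have hcj := hτ'.isCorner hj hjs
    rw [← hw] at hcj hv
    -- Going back to `τ` gives `l > i` at the same position, hence `p_{i+1} = p_i`. The missing
    -- value `v` lies in one of the two intervals shown to be fully used.
    obtain ⟨l, hl, hls, hPl, hQl⟩ := hτ.exists_of_isCorner hcj
    have hQle : τ.Q l ≤ τ'.Q j := hQl.elim le_of_eq fun h => h.1.le
    have hil : i < l := by
      by_contra! h
      have := hτ.Q_le hl h his
      omega
    have hai : τ.a ≤ i := by
      by_contra! h
      have := hτ.Q_pos hi h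
      omega
    have h1 := hτ.P_le (i := i) (j := i + 1) hi (by omega) (by omega)
    have h2 := hτ.P_le (i := i + 1) (j := l) (by omega) hil hls
    have h3 := hτ.Q_le (i := i + 1) (j := l) (by omega) hil hls
    obtain ⟨v, hv1, hv2, hv3⟩ := hτ.exists_unused_of_P_eq hai (by omega) (by omega)
    by_cases hvj : v ≤ -τ'.Q j
    · obtain ⟨z, hz, hzv⟩ := hv v hv1 hvj
      exact hv3 z hz hzv
    · rcases hQl with h | ⟨-, -, h⟩
      · omega
      · obtain ⟨z, hz, hzv⟩ := h v (by omega) (by omega)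
        exact hv3 z (by omega) hzv

theorem exists_eq_of_w_eq (hτ : τ.IsThetaTriple) (hτ' : τ'.IsThetaTriple) (hw : τ.w = τ'.w)
    (c : Fin τ.s) : ∃ d : Fin τ'.s, τ'.k d = τ.k c ∧ τ'.p d = τ.p c ∧ τ'.q d = τ.q c := by
  have hc : (c : ℕ) + 1 ≤ τ.s := c.2
  obtain ⟨j, hj, hjs, hP, hQ⟩ := hτ.exists_corner_eq hτ' hw (by omega) hc
  have hK : τ'.K j = τ.K (c + 1) := by
    rw [hτ.K_eq (by omega) hc, hτ'.K_eq hj hjs, hP, hQ, hw]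
  obtain ⟨d, rfl⟩ := exists_fin hj hjs
  exact ⟨d, by rw [← K_succ, hK, K_succ], by rw [← P_succ, hP, P_succ],
    by rw [← Q_succ, hQ, Q_succ]⟩

theorem eq_of_w_eq (hτ : τ.IsThetaTriple) (hτ' : τ'.IsThetaTriple) (hw : τ.w = τ'.w) :
    τ = τ' := by
  have h := hτ.exists_eq_of_w_eq hτ' hw
  have h' := hτ'.exists_eq_of_w_eq hτ hw.symm
  have hk := hτ.k_strictMono
  have hk' := hτ'.k_strictMono
  obtain ⟨s, k, p, q⟩ := τ
  obtain ⟨s', k', p', q'⟩ := τ'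
  dsimp only at h h' hk hk'
  -- A strictly increasing tuple is determined by its set of values, which also fixes `s`;
  -- injectivity of `k` then matches the p's and q's.
  have hrange : Set.range k = Set.range k' := by
    apply Set.Subset.antisymm
    · rintro _ ⟨c, rfl⟩
      obtain ⟨d, hd, -⟩ := h c
      exact ⟨d, hd⟩
    · rintro _ ⟨c, rfl⟩
      obtain ⟨d, hd, -⟩ := h' c
      exact ⟨d, hd⟩
  have hs : s = s' := by
    have h1 := congrArg Set.ncard hrange
    rwa [← Set.image_univ, ← Set.image_univ, hk.injective.injOn.ncard_image,
      hk'.injective.injOn.ncard_image, Set.ncard_univ, Set.ncard_univ, Nat.card_fin,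
      Nat.card_fin] at h1
  subst hs
  have hkk : k = k' := (hk.range_inj hk').1 hrange
  subst hkk
  have hpq : ∀ c, p' c = p c ∧ q' c = q c := by
    intro c
    obtain ⟨d, hd, hpd⟩ := h c
    rwa [hk.injective hd] at hpd
  rw [funext fun c => (hpq c).1, funext fun c => (hpq c).2]

end IsThetaTriple

end ThetaData

theorem mainTheorem2 :
    (∀ (n : ℕ) (w : Equiv.Perm ℤ), w ∈ signedPerm n → IsThetaVexillary w →
      ∃! τ : ThetaData, ComesFrom w τ) ∧
    (∀ τ τ' : ThetaData, τ.IsThetaTriple → τ'.IsThetaTriple → τ.w = τ'.w → τ = τ') := by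
  refine ⟨fun n w _ ⟨τ, hτ⟩ => ⟨τ, hτ, fun τ' hτ' => ?_⟩, fun τ τ' hτ hτ' h => hτ.eq_of_w_eq hτ' h⟩
  exact hτ'.1.eq_of_w_eq hτ.1 (funext fun i => (hτ'.2 i).symm.trans (hτ.2 i))
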